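/- Let $f:(\mathbb C^2,0)\to(\mathbb C,0)$ be a holomorphic function germ that is mini-regular in $x$: if $f=f_m+f_{m+1}+\cdots$ is the homogeneous Taylor expansion with $m=\operatorname{ord}_0 f$, then $f_m(1,0)\neq 0$. A Puiseux arc is a convergent fractional power series $\eta(y)=\varphi(y^{1/N})$ ($N\ge 1$, $\varphi$ a convergent power series). If $\operatorname{ord}\eta\ge 1$, then $\eta_*$ denotes the curve germ at $0\in\mathbb C^2$ that is the image of $t\mapsto(\varphi(t),t^N)$. A polar arc of $f$ is a Puiseux arc $\gamma$ with $\operatorname{ord}\gamma\ge 1$, $f(\gamma(y),y)\not\equiv 0$ and $f_x(\gamma(y),y)\equiv 0$. Its gradient degree $d(\gamma)$ is the smallest rational number $q>0$ such that $\operatorname{ord}\|\operatorname{grad}f(\gamma(y),y)\|=\operatorname{ord}\|\operatorname{grad}f(\gamma(y)+uy^{q},y)\|$ for all but finitely many $u\in\mathbb C$. Its gradient canyon $\mathcal{GC}(\gamma_*)$ is the set of all curve germs $\alpha_*$, where $\alpha(y)=\gamma(y)+uy^{d(\gamma)}+\text{(terms of higher order)}$ for some $u\in\mathbb C$; the degree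 of the canyon is $d(\gamma)$. For a polar arc $\gamma$ write $f_x(X+\gamma(Y),Y)=\sum c_{ij}X^iY^j$ with $i\in\mathbb Z_{\ge0}$, $j\in\mathbb Q_{\ge 0}$. The Newton polygon $\mathcal{NP}(f_x,\gamma)\subset\mathbb R^2$ is the boundary of the convex hull of $\{(i+u,j+v)\mid c_{ij}\ne0,\ u,v\ge0\}$. With $h(\gamma):=\operatorname{ord}f(\gamma(y),y)$, the augmented Newton polygon is $$\widehat{\mathcal{NP}}(f_x,\gamma):=\operatorname{Conv}\bigl(\mathcal{NP}(f_x,\gamma)\cup\{(0,h(\gamma)-1)\}\bigr)\subset\mathbb R^2 .$$ Lemma. Let $\mathcal C$ be a gradient canyon of $f$ of degree $d>1$. If $\gamma_1,\gamma_2$ are polar arcs of $f$ with $\gamma_{1,*},\gamma_{2,*}\in\mathcal C$, then $$\widehat{\mathcal{NP}}(f_x,\gamma_1)=\widehat{\mathcal{NP}}(f_x,\gamma_2).$$ Consequently, the augmented polygon depends only on the canyon: there is a map $\mathcal C\mapsto\widehat{\mathcal{NP}}(f_x,\mathcal C)$ such that $\widehat{\mathcal{NP}}(f_x,\gamma)=\widehat{\mathcal{NP}}(f_x,\mathcal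 C)$ for every gradient canyon $\mathcal C$ of $f$ of degree $>1$ and every polar arc $\gamma$ of $f$ with $\gamma_*\in\mathcal C$. -/

import Mathlib

open Filter Topology

/-- A fractional power series `η(y) = φ(y^{1/N})` with `N ≥ 1` and `φ` a convergent power series,
given by `N = ram` and the holomorphic germ `φ = fn` at `0`. Neither `N` minimal nor a choice of
`φ` away from `0` matters: all notions below depend only on the series `η`. -/
structure PuiseuxArc where
  ram : ℕ
  ram_pos : 0 < ram
  fn : ℂ → ℂ
  analyticAt_fn : AnalyticAt ℂ fn 0

/-- The order in `y` of `g(y^{1/N})`, for `g` holomorphic near `0`; it is `⊤` if `g` vanishes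
identically near `0`. -/
noncomputable def fracOrd (N : ℕ) (g : ℂ → ℂ) : WithTop ℚ :=
  WithTop.map (fun n : ℕ => (n : ℚ) / (N : ℚ)) (analyticOrderAt g 0)

namespace PuiseuxArc

/-- `ord η`. -/
noncomputable def ord (η : PuiseuxArc) : WithTop ℚ := fracOrd η.ram η.fn

/-- The point `(η(y), y)` for `y = t ^ N`, that is `(φ(t), t ^ N)`. -/
noncomputable def par (η : PuiseuxArc) (t : ℂ) : ℂ × ℂ := (η.fn t, t ^ η.ram)

/-- The curve germ `η_*`: the germ at the origin of the image of `t ↦ (φ(t), t ^ N)`. Points of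
the image near the origin come from small `t`, since `|t| ^ N` is the size of the second
coordinate. -/
noncomputable def curveGerm (η : PuiseuxArc) : Germ (𝓝 (0 : ℂ × ℂ)) Prop :=
  ((fun p : ℂ × ℂ => ∃ t : ℂ, η.par t = p) : Germ (𝓝 (0 : ℂ × ℂ)) Prop)

/-- The difference `α(y) - β(y)`, written over the common ramification. -/
noncomputable def sub (α β : PuiseuxArc) : PuiseuxArc where
  ram := α.ram * β.ram
  ram_pos := Nat.mul_pos α.ram_pos β.ram_pos
  fn := fun t => α.fn (t ^ β.ram) - β.fn (t ^ α.ram)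
  analyticAt_fn := by
    have ha : AnalyticAt ℂ (fun t : ℂ => α.fn (t ^ β.ram)) 0 :=
      AnalyticAt.fun_comp (by simpa [β.ram_pos.ne'] using α.analyticAt_fn) (by fun_prop)
    have hb : AnalyticAt ℂ (fun t : ℂ => β.fn (t ^ α.ram)) 0 :=
      AnalyticAt.fun_comp (by simpa [α.ram_pos.ne'] using β.analyticAt_fn) (by fun_prop)
    exact ha.sub hb

/-- The series `γ(y) + u y^q`, for a rational exponent `q ≥ 0`. -/
noncomputable def addMonomial (γ : PuiseuxArc) (u : ℂ) (q : ℚ) : PuiseuxArc where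
  ram := γ.ram * q.den
  ram_pos := Nat.mul_pos γ.ram_pos q.den_pos
  fn := fun t => γ.fn (t ^ q.den) + u * t ^ (γ.ram * q.num.toNat)
  analyticAt_fn := by
    have ha : AnalyticAt ℂ (fun t : ℂ => γ.fn (t ^ q.den)) 0 :=
      AnalyticAt.fun_comp (by simpa [q.den_ne_zero] using γ.analyticAt_fn) (by fun_prop)
    exact ha.add (by fun_prop)

end PuiseuxArc

/-- `ord f(η(y), y)`. -/
noncomputable def ordAlong (f : ℂ × ℂ → ℂ) (η : PuiseuxArc) : WithTop ℚ :=
  fracOrd η.ram (fun t => f (η.par t))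

/-- The partial derivative `f_x`. -/
noncomputable def partialX (f : ℂ × ℂ → ℂ) : ℂ × ℂ → ℂ :=
  fun p => deriv (fun x => f (x, p.2)) p.1

/-- The partial derivative `f_y`. -/
noncomputable def partialY (f : ℂ × ℂ → ℂ) : ℂ × ℂ → ℂ :=
  fun p => deriv (fun y => f (p.1, y)) p.2

/-- `ord ‖grad f(η(y), y)‖`: the order of a vector is the least order of its components. -/
noncomputable def gradOrdAlong (f : ℂ × ℂ → ℂ) (η : PuiseuxArc) : WithTop ℚ :=
  min (ordAlong (partialX f) η) (ordAlong (partialY f) η)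

/-- The value at `v` of the homogeneous part `f_k` of degree `k` of the Taylor expansion of `f` at
the origin: the coefficient of `s ^ k` in `f(s v) = ∑ f_k(v) s ^ k`. -/
noncomputable def taylorForm (f : ℂ × ℂ → ℂ) (k : ℕ) (v : ℂ × ℂ) : ℂ :=
  iteratedDeriv k (fun s : ℂ => f (s • v)) 0 / (k.factorial : ℂ)

/-- `f` is mini-regular in `x`: with `m = ord_0 f`, the initial form satisfies `f_m(1, 0) ≠ 0`. -/
def MiniRegularInX (f : ℂ × ℂ → ℂ) : Prop :=
  ∃ m : ℕ, (∀ k < m, ∀ v : ℂ × ℂ, taylorForm f k v = 0) ∧ taylorForm f m (1, 0) ≠ 0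

/-- `γ` is a polar arc of `f`: a Puiseux arc of order at least `1` (an arc at the origin) with
`f(γ(y), y) ≢ 0` and `f_x(γ(y), y) ≡ 0`. -/
def IsPolarArc (f : ℂ × ℂ → ℂ) (γ : PuiseuxArc) : Prop :=
  1 ≤ γ.ord ∧ (¬ ∀ᶠ t in 𝓝 (0 : ℂ), f (γ.par t) = 0) ∧
    ∀ᶠ t in 𝓝 (0 : ℂ), partialX f (γ.par t) = 0

/-- `d` is the gradient degree of `γ`: the smallest `q` such that
`ord ‖grad f(γ(y), y)‖ = ord ‖grad f(γ(y) + u y^q, y)‖` for generic (all but finitely many) `u`. -/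
def IsGradientDegree (f : ℂ × ℂ → ℂ) (γ : PuiseuxArc) (d : ℚ) : Prop :=
  IsLeast {q : ℚ | 0 < q ∧ ∀ᶠ u : ℂ in cofinite,
    gradOrdAlong f γ = gradOrdAlong f (γ.addMonomial u q)} d

/-- For `d` the gradient degree of `γ`, the set of all curve germs `α_*` with
`α(y) = γ(y) + u y^d + h.o.t.` for some `u`. -/
noncomputable def canyonOf (γ : PuiseuxArc) (d : ℚ) : Set (Germ (𝓝 (0 : ℂ × ℂ)) Prop) :=
  {A | ∃ (α : PuiseuxArc) (u : ℂ),
    (d : WithTop ℚ) < (α.sub (γ.addMonomial u d)).ord ∧ α.curveGerm = A}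

/-- `C` is a gradient canyon of `f` of degree `d`. -/
def IsGradientCanyon (f : ℂ × ℂ → ℂ) (C : Set (Germ (𝓝 (0 : ℂ × ℂ)) Prop)) (d : ℚ) : Prop :=
  ∃ γ : PuiseuxArc, IsPolarArc f γ ∧ IsGradientDegree f γ d ∧ C = canyonOf γ d

/-- The coefficient of `X ^ i * t ^ j`, `t = Y^{1/N}`, in the expansion of `g(X + η(Y), Y)`. -/
noncomputable def relCoeff (g : ℂ × ℂ → ℂ) (η : PuiseuxArc) (i j : ℕ) : ℂ :=
  iteratedDeriv j (fun t : ℂ =>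
    iteratedDeriv i (fun X : ℂ => g (X + η.fn t, t ^ η.ram)) 0 / (i.factorial : ℂ)) 0
      / (j.factorial : ℂ)

/-- The Newton dots of `g(X + η(Y), Y)`. -/
def newtonDots (g : ℂ × ℂ → ℂ) (η : PuiseuxArc) : Set (ℝ × ℝ) :=
  {p | ∃ i j : ℕ, relCoeff g η i j ≠ 0 ∧ p = ((i : ℝ), (j : ℝ) / (η.ram : ℝ))}

/-- The Newton polygon of `g` relative to `η`: the boundary of the convex hull of all
`(i + u, j + v)` with `u, v ≥ 0` and `(i, j)` a Newton dot. -/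
def newtonPolygon (g : ℂ × ℂ → ℂ) (η : PuiseuxArc) : Set (ℝ × ℝ) :=
  frontier (convexHull ℝ
    {p : ℝ × ℝ | ∃ e ∈ newtonDots g η, ∃ u v : ℝ, 0 ≤ u ∧ 0 ≤ v ∧ p = (e.1 + u, e.2 + v)})

/-- `h(γ) = ord f(γ(y), y)`, which is finite for a polar arc. -/
noncomputable def polarHeight (f : ℂ × ℂ → ℂ) (γ : PuiseuxArc) : ℚ :=
  (ordAlong f γ).untopD 0

/-- The augmented Newton polygon of `f_x` along `γ`: the convex hull of the Newton polygon of `f_x`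
relative to `γ` together with the point `(0, h(γ) - 1)`. -/
noncomputable def augmentedNewtonPolygon (f : ℂ × ℂ → ℂ) (γ : PuiseuxArc) : Set (ℝ × ℝ) :=
  convexHull ℝ (newtonPolygon (partialX f) γ ∪ {((0 : ℝ), (polarHeight f γ : ℝ) - 1)})

/-!
Write `g_i` for the `i`-th derivative of `g` in `x`. The coefficient of `X ^ i` in
`g(X + η(y), y)` is `g_i(η(y), y) / i!`, so the lowest Newton dot of `g` along `η` in column `i`
is `(i, ord g_i(η(y), y))`, if that order is finite. Everything is read off from these orders,
taken for `g = f_x`.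

Let `γ` be a polar arc of gradient degree `d > 1` and height `h`. Since `f_x` vanishes along `γ`,
the chain rule gives `ord f_y = h - 1` along `γ`, so the gradient has order `h - 1` there. By the
definition of `d`, for generic `u` the order of `f_x` along `γ + u y ^ d` is then at least `h - 1`.
As `u` varies the Taylor terms of `f_x` cannot cancel, so every dot `(i, e)` satisfies
`h - 1 ≤ e + d i`: all dots lie on or above the line of slope `-d` through `(0, h - 1)`
(`polarHeight_sub_one_le`).

Let `β` be another polar arc whose germ lies in the canyon of `γ`. Equality of germs means equality
of series up to a choice of the root `y ^ {1/N}`, which does not affect orders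
(`ordAlong_eq_of_curveGerm_eq`), so one may assume `β = γ + O(y ^ d)`. Re-expanding `f_x` around
`β` moves a dot `(i, e)` of `γ` to points on or above `(i - k, e + d k)`, that is along the line of
slope `-d` to the left, and the situation is symmetric in `β` and `γ`. Likewise `f(β) - f(γ)` has
order at least `h - 1 + d > h`, so both arcs have height `h`
(`polarHeight_eq_and_newtonDominates`).

Finally, the augmented polygon is the convex hull of the point `(0, h - 1)` and of the quadrants
over the dots (`augmentedNewtonPolygon_eq`); here one needs that the hull of the quadrants is closed
and is the convex hull of its boundary. The point `(i - k, e + d k)` with `i - k > 0` lies on or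
above the segment from `(0, h - 1)` to `(i, e)`, because `h - 1 ≤ e + d i`. So each polygon contains
the other (`augmentedNewtonPolygon_subset`).
-/

/-! ### Iterated partial derivatives and Taylor expansion in `x` -/

theorem partialX_eventuallyEq_fderiv {g : ℂ × ℂ → ℂ} {p : ℂ × ℂ} (hg : AnalyticAt ℂ g p) :
    partialX g =ᶠ[𝓝 p] fun q => fderiv ℂ g q (1, 0) := by
  filter_upwards [hg.eventually_analyticAt] with q hq
  have h1 : HasFDerivAt g (fderiv ℂ g q) ((fun x : ℂ => (x, q.2)) q.1) :=
    hq.differentiableAt.hasFDerivAt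
  have h2 : HasDerivAt (fun x : ℂ => (x, q.2)) ((1 : ℂ), (0 : ℂ)) q.1 :=
    (hasDerivAt_id _).prodMk (hasDerivAt_const _ _)
  exact (h1.comp_hasDerivAt q.1 h2).deriv

theorem partialY_eventuallyEq_fderiv {g : ℂ × ℂ → ℂ} {p : ℂ × ℂ} (hg : AnalyticAt ℂ g p) :
    partialY g =ᶠ[𝓝 p] fun q => fderiv ℂ g q (0, 1) := by
  filter_upwards [hg.eventually_analyticAt] with q hq
  have h1 : HasFDerivAt g (fderiv ℂ g q) ((fun y : ℂ => (q.1, y)) q.2) :=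
    hq.differentiableAt.hasFDerivAt
  have h2 : HasDerivAt (fun y : ℂ => (q.1, y)) ((0 : ℂ), (1 : ℂ)) q.2 :=
    (hasDerivAt_const _ _).prodMk (hasDerivAt_id _)
  exact (h1.comp_hasDerivAt q.2 h2).deriv

theorem AnalyticAt.partialX {g : ℂ × ℂ → ℂ} {p : ℂ × ℂ} (hg : AnalyticAt ℂ g p) :
    AnalyticAt ℂ (partialX g) p :=
  (((ContinuousLinearMap.apply ℂ ℂ ((1 : ℂ), (0 : ℂ))).analyticAt _).comp hg.fderiv).congr
    (partialX_eventuallyEq_fderiv hg).symm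

theorem AnalyticAt.partialY {g : ℂ × ℂ → ℂ} {p : ℂ × ℂ} (hg : AnalyticAt ℂ g p) :
    AnalyticAt ℂ (partialY g) p :=
  (((ContinuousLinearMap.apply ℂ ℂ ((0 : ℂ), (1 : ℂ))).analyticAt _).comp hg.fderiv).congr
    (partialY_eventuallyEq_fderiv hg).symm

theorem AnalyticAt.iterate_partialX {g : ℂ × ℂ → ℂ} {p : ℂ × ℂ} (hg : AnalyticAt ℂ g p) (i : ℕ) :
    AnalyticAt ℂ (_root_.partialX^[i] g) p := by
  induction i with
  | zero => exact hg
  | succ i ih => rw [Function.iterate_succ_apply']; exact ih.partialX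

theorem iteratedDeriv_eq_iterate_partialX (g : ℂ × ℂ → ℂ) (i : ℕ) (x y : ℂ) :
    iteratedDeriv i (fun X => g (X + x, y)) 0 = (partialX^[i] g) (x, y) := by
  have key : ∀ x, iteratedDeriv i (fun X => g (X, y)) x = (partialX^[i] g) (x, y) := by
    induction i with
    | zero => simp
    | succ i ih =>
      intro x
      rw [iteratedDeriv_succ, Function.iterate_succ_apply', partialX]
      congr 1
      exact funext ih
  rw [iteratedDeriv_comp_add_const (f := fun X => g (X, y))]
  simpa using key x

/-- Taylor expansion in the first variable, with a remainder that is uniform in the base point. It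
follows by induction on `n` from the mean value inequality, as differentiating the remainder of
order `n + 1` of `g` in `X` gives the remainder of order `n` of `g_x`. -/
theorem exists_taylor_bound_partialX (n : ℕ) {g : ℂ × ℂ → ℂ} (hg : AnalyticAt ℂ g 0) :
    ∃ C r : ℝ, 0 < r ∧ ∀ x X y : ℂ, ‖x‖ < r → ‖X‖ < r → ‖y‖ < r →
      ‖g (x + X, y) - ∑ i ∈ Finset.range n, (partialX^[i] g) (x, y) * (X ^ i / i.factorial)‖
        ≤ C * ‖X‖ ^ n := by
  induction n generalizing g with
  | zero =>
    have hb : ∀ᶠ p in 𝓝 (0 : ℂ × ℂ), ‖g p‖ < ‖g 0‖ + 1 :=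
      hg.continuousAt.norm.eventually_lt continuousAt_const (by simp)
    obtain ⟨ε, hε, hb⟩ := Metric.eventually_nhds_iff.1 hb
    refine ⟨‖g 0‖ + 1, ε / 2, by positivity, fun x X y hx hX hy => ?_⟩
    have : ‖g (x + X, y)‖ < ‖g 0‖ + 1 := by
      apply hb
      rw [dist_zero_right, Prod.norm_def]
      exact max_lt (by linarith [norm_add_le x X]) (by simpa using by linarith)
    simpa using this.le
  | succ n ih =>
    obtain ⟨C, r, hr, hC⟩ := ih hg.partialX
    obtain ⟨ε, hε, han⟩ := Metric.eventually_nhds_iff.1 hg.eventually_analyticAt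
    refine ⟨C, min r (ε / 2), by positivity, fun x X y hx hX hy => ?_⟩
    have hC0 : 0 ≤ C * ‖X‖ ^ n := (norm_nonneg _).trans
      (hC x X y (hx.trans_le (min_le_left _ _)) (hX.trans_le (min_le_left _ _))
        (hy.trans_le (min_le_left _ _)))
    -- `0 ≤ C * ‖X‖ ^ n` determines the sign of `C` except when `X = 0` and `n ≠ 0`
    have hCn : 0 ≤ C ∨ X = 0 ∧ n ≠ 0 := by
      rcases eq_or_ne X 0 with h | h
      · rcases eq_or_ne n 0 with h' | h'
        · subst h'; left; simpa using hC0
        · exact Or.inr ⟨h, h'⟩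
      · left
        exact nonneg_of_mul_nonneg_left hC0 (by positivity)
    set h : ℂ → ℂ := fun Z => g (x + Z, y) -
      ∑ i ∈ Finset.range (n + 1), (partialX^[i] g) (x, y) * (Z ^ i / i.factorial) with hh
    set h' : ℂ → ℂ := fun Z => partialX g (x + Z, y) -
      ∑ i ∈ Finset.range n, (partialX^[i] (partialX g)) (x, y) * (Z ^ i / i.factorial) with hh'
    have hderiv : ∀ Z ∈ Metric.closedBall (0 : ℂ) ‖X‖,
        HasDerivWithinAt h (h' Z) (Metric.closedBall 0 ‖X‖) Z := by
      intro Z hZ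
      rw [mem_closedBall_zero_iff] at hZ
      apply HasDerivAt.hasDerivWithinAt
      apply HasDerivAt.sub
      · have hq : AnalyticAt ℂ g (x + Z, y) := by
          apply han
          rw [dist_zero_right, Prod.norm_def]
          have := min_le_right r (ε / 2)
          exact max_lt (by linarith [norm_add_le x Z]) (by simpa using by linarith)
        have hd : DifferentiableAt ℂ (fun w => g (w, y)) (x + Z) :=
          hq.differentiableAt.comp (f := fun w : ℂ => (w, y)) (x + Z) (by fun_prop)
        exact hd.hasDerivAt.comp_const_add x Z
      · rw [show (fun Z : ℂ => ∑ i ∈ Finset.range (n + 1),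
            (partialX^[i] g) (x, y) * (Z ^ i / i.factorial)) = fun Z : ℂ =>
            (∑ i ∈ Finset.range n, (partialX^[i] (partialX g)) (x, y) *
              (Z ^ (i + 1) / (i + 1).factorial)) + g (x, y) from by
          funext Z
          rw [Finset.sum_range_succ']
          simp]
        apply HasDerivAt.add_const
        apply HasDerivAt.fun_sum
        intro i _
        apply HasDerivAt.const_mul
        have := (hasDerivAt_pow (i + 1) Z).div_const ((i + 1).factorial : ℂ)
        convert this using 1
        have h1 : ((i : ℂ) + 1) ≠ 0 := by exact_mod_cast Nat.succ_ne_zero i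
        have h2 : (i.factorial : ℂ) ≠ 0 := by exact_mod_cast i.factorial_ne_zero
        rw [Nat.factorial_succ]
        push_cast
        field_simp
    have hbound : ∀ Z ∈ Metric.closedBall (0 : ℂ) ‖X‖, ‖h' Z‖ ≤ C * ‖X‖ ^ n := by
      intro Z hZ
      rw [mem_closedBall_zero_iff] at hZ
      rcases hCn with h0 | ⟨rfl, hn⟩
      · refine (hC x Z y (hx.trans_le (min_le_left _ _))
          ((hZ.trans_lt hX).trans_le (min_le_left _ _)) (hy.trans_le (min_le_left _ _))).trans ?_
        gcongr
      · obtain rfl : Z = 0 := by simpa using hZ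
        exact hC x 0 y (hx.trans_le (min_le_left _ _)) (by simpa using hr)
          (hy.trans_le (min_le_left _ _))
    have := (convex_closedBall (0 : ℂ) ‖X‖).norm_image_sub_le_of_norm_hasDerivWithin_le hderiv
      hbound (x := 0) (y := X) (by simp) (by simp)
    have h0 : h 0 = 0 := by
      simp [hh, Finset.sum_range_succ']
    rw [h0, sub_zero, sub_zero, mul_assoc, ← pow_succ] at this
    exact this

/-! ### Orders of vanishing along a parametrized curve -/

theorem natCast_le_analyticOrderAt_iff_isBigO {a : ℂ → ℂ} (ha : AnalyticAt ℂ a 0) (w : ℕ) :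
    (w : ℕ∞) ≤ analyticOrderAt a 0 ↔ a =O[𝓝 0] fun t => t ^ w := by
  constructor
  · intro h
    obtain ⟨b, hb, hab⟩ := (natCast_le_analyticOrderAt ha).1 h
    have hb1 : b =O[𝓝 0] fun _ => (1 : ℂ) := hb.continuousAt.isBigO_one ℂ
    refine (((Asymptotics.isBigO_refl (fun t : ℂ => t ^ w) (𝓝 0)).mul hb1).congr' ?_ ?_)
    · filter_upwards [hab] with t ht
      simp [ht]
    · simp
  · intro h
    by_contra hlt
    rw [not_le] at hlt
    obtain ⟨m, hm⟩ := ENat.ne_top_iff_exists.1 (ne_top_of_lt hlt)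
    rw [← hm, Nat.cast_lt] at hlt
    obtain ⟨b, hb, hb0, hab⟩ := (ha.analyticOrderAt_eq_natCast).1 hm.symm
    -- otherwise `a = t ^ m b` with `b 0 ≠ 0` and `m < w`, so `t ^ m = O(a) = O(t ^ w) = o(t ^ m)`
    have h2 : (fun t : ℂ => t ^ w) =o[𝓝 0] fun t : ℂ => t ^ m :=
      Asymptotics.isLittleO_pow_pow hlt
    have h3 : (fun t : ℂ => t ^ m) =O[𝓝 0] a := by
      have hinv : (fun t => (b t)⁻¹) =O[𝓝 0] fun _ => (1 : ℂ) :=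
        (hb.continuousAt.inv₀ hb0).isBigO_one ℂ
      refine ((Asymptotics.isBigO_refl a (𝓝 0)).mul hinv).congr' ?_ (by simp)
      filter_upwards [hab, hb.continuousAt.eventually_ne hb0] with t ht hbt
      simp [ht, hbt]
    have h4 := (h3.trans h).trans_isLittleO h2
    refine Asymptotics.isLittleO_irrefl ?_ h4
    have hne : ∀ᶠ t : ℂ in 𝓝[≠] (0 : ℂ), t ≠ 0 := eventually_mem_nhdsWithin
    exact (hne.frequently.filter_mono nhdsWithin_le_nhds).mono fun t ht => pow_ne_zero m ht

theorem analyticOrderAt_pow_zero (k : ℕ) : analyticOrderAt (fun t : ℂ => t ^ k) 0 = k := by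
  have := analyticOrderAt_centeredMonomial (z₀ := (0 : ℂ)) (n := k)
  simp only [sub_zero] at this
  exact this

theorem isBigO_pow_pow_of_le {k l : ℕ} (h : k ≤ l) :
    (fun t : ℂ => t ^ l) =O[𝓝 0] fun t : ℂ => t ^ k := by
  rcases h.eq_or_lt with rfl | h
  · exact Asymptotics.isBigO_refl _ _
  · exact (Asymptotics.isLittleO_pow_pow h).isBigO

theorem isBigO_mul_pow_iff {a : ℂ → ℂ} (ha : AnalyticAt ℂ a 0) (k w : ℕ) :
    (fun t => a t * t ^ k) =O[𝓝 0] (fun t : ℂ => t ^ w) ↔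
      (w : ℕ∞) ≤ analyticOrderAt a 0 + (k : ℕ∞) := by
  have hk : AnalyticAt ℂ (fun t : ℂ => t ^ k) 0 := by fun_prop
  rw [← analyticOrderAt_pow_zero k, ← analyticOrderAt_mul ha hk]
  exact (natCast_le_analyticOrderAt_iff_isBigO (ha.mul hk) w).symm

theorem analyticOrderAt_comp_pow {a : ℂ → ℂ} (ha : AnalyticAt ℂ a 0) {k : ℕ} (hk : k ≠ 0) :
    analyticOrderAt (fun t => a (t ^ k)) 0 = analyticOrderAt a 0 * k := by
  have := AnalyticAt.analyticOrderAt_comp (f := a) (g := fun t : ℂ => t ^ k) (z₀ := 0)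
    (by simpa [hk] using ha) (by fun_prop)
  simpa [hk, analyticOrderAt_pow_zero, Function.comp_def] using this

theorem AnalyticAt.comp_curve {g : ℂ × ℂ → ℂ} (hg : AnalyticAt ℂ g 0) {φ : ℂ → ℂ}
    (hφ : AnalyticAt ℂ φ 0) (h0 : φ 0 = 0) {N : ℕ} (hN : N ≠ 0) :
    AnalyticAt ℂ (fun t => g (φ t, t ^ N)) 0 := by
  have h1 : AnalyticAt ℂ (fun t : ℂ => (φ t, t ^ N)) 0 := hφ.prod (by fun_prop)
  exact AnalyticAt.fun_comp (g := g) (by simpa [h0, hN, Prod.mk_zero_zero] using hg) h1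

theorem isBigO_taylor_along_curve {g : ℂ × ℂ → ℂ} (hg : AnalyticAt ℂ g 0) {φ δ : ℂ → ℂ}
    (hφ : Tendsto φ (𝓝 0) (𝓝 0)) (hδ : Tendsto δ (𝓝 0) (𝓝 0)) {N : ℕ} (hN : N ≠ 0) (n : ℕ) :
    (fun t => g (φ t + δ t, t ^ N) - ∑ i ∈ Finset.range n,
      (partialX^[i] g) (φ t, t ^ N) * (δ t ^ i / i.factorial)) =O[𝓝 0] fun t => δ t ^ n := by
  obtain ⟨C, r, hr, hC⟩ := exists_taylor_bound_partialX n hg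
  have hpow : Tendsto (fun t : ℂ => t ^ N) (𝓝 0) (𝓝 0) := by
    have : ContinuousAt (fun t : ℂ => t ^ N) 0 := by fun_prop
    simpa [ContinuousAt, hN] using this
  refine Asymptotics.IsBigO.of_bound C ?_
  have hball := Metric.ball_mem_nhds (0 : ℂ) hr
  filter_upwards [hφ hball, hδ hball, hpow hball] with t h1 h2 h3
  simp only [Set.mem_preimage, mem_ball_zero_iff] at h1 h2 h3
  simpa [norm_pow] using hC _ _ _ h1 h2 h3

/-- If `δ = O(t ^ D)` and every term `g_i(φ) δ ^ i` with `i ≥ 1` of the Taylor expansion has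
order at least `w`, then moving the curve `φ` by `δ` changes `g` by `O(t ^ w)`. -/
theorem isBigO_sub_along_curve {g : ℂ × ℂ → ℂ} (hg : AnalyticAt ℂ g 0) {φ δ : ℂ → ℂ}
    (hφ : AnalyticAt ℂ φ 0) (h0 : φ 0 = 0) {N D : ℕ} (hN : N ≠ 0) (hD : D ≠ 0)
    (hδ : δ =O[𝓝 0] fun t : ℂ => t ^ D) {w : ℕ}
    (hw : ∀ i, 1 ≤ i → (w : ℕ∞) ≤
      analyticOrderAt (fun t => (partialX^[i] g) (φ t, t ^ N)) 0 + (D * i : ℕ)) :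
    (fun t => g (φ t + δ t, t ^ N) - g (φ t, t ^ N)) =O[𝓝 0] fun t : ℂ => t ^ w := by
  have hφt : Tendsto φ (𝓝 0) (𝓝 0) := by simpa [ContinuousAt, h0] using hφ.continuousAt
  have hδt : Tendsto δ (𝓝 0) (𝓝 0) := by
    refine hδ.trans_tendsto ?_
    have : ContinuousAt (fun t : ℂ => t ^ D) 0 := by fun_prop
    simpa [ContinuousAt, hD] using this
  -- as `D ≥ 1`, the terms of degree above `w` in `δ` are `O(t ^ w)`
  have hT := isBigO_taylor_along_curve hg hφt hδt hN (w + 1)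
  have hrem : (fun t => δ t ^ (w + 1)) =O[𝓝 0] fun t : ℂ => t ^ w := by
    refine (hδ.pow (w + 1)).trans ?_
    simp only [← pow_mul]
    exact isBigO_pow_pow_of_le (by nlinarith [Nat.pos_of_ne_zero hD])
  have hsum : (fun t => ∑ i ∈ Finset.range w, (partialX^[i + 1] g) (φ t, t ^ N) *
      (δ t ^ (i + 1) / (i + 1).factorial)) =O[𝓝 0] fun t : ℂ => t ^ w := by
    refine Asymptotics.IsBigO.fun_sum fun i _ => ?_
    have han := (hg.iterate_partialX (i + 1)).comp_curve hφ h0 hN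
    refine Asymptotics.IsBigO.trans ?_ ((isBigO_mul_pow_iff han _ _).2 (hw (i + 1) (by omega)))
    refine (Asymptotics.isBigO_refl _ _).mul ?_
    simp only [div_eq_inv_mul]
    refine Asymptotics.IsBigO.const_mul_left ?_ _
    simpa only [← pow_mul] using hδ.pow (i + 1)
  refine ((hT.trans hrem).add hsum).congr_left fun t => ?_
  rw [Finset.sum_range_succ']
  simp only [Function.iterate_zero, id_eq, pow_zero, Nat.factorial_zero, Nat.cast_one, div_one,
    mul_one]
  ring

/-- If `g` has order at least `w` along the curves `φ + u t ^ D` for infinitely many `u`, then so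
has every term `g_i(φ) t ^ {D i}` of the Taylor expansion: up to `O(t ^ w)` the function
`u ↦ g(φ + u t ^ D)` is a polynomial in `u` of bounded degree, whose coefficients are fixed
linear combinations of finitely many of its values, by Lagrange interpolation. -/
theorem le_order_iterate_partialX_of_infinite {g : ℂ × ℂ → ℂ} (hg : AnalyticAt ℂ g 0) {φ : ℂ → ℂ}
    (hφ : AnalyticAt ℂ φ 0) (h0 : φ 0 = 0) {N D : ℕ} (hN : N ≠ 0) (hD : D ≠ 0) {w : ℕ}
    {U : Set ℂ} (hU : U.Infinite)
    (hw : ∀ u ∈ U, (fun t => g (φ t + u * t ^ D, t ^ N)) =O[𝓝 0] fun t : ℂ => t ^ w) (i : ℕ) :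
    (w : ℕ∞) ≤ analyticOrderAt (fun t => (partialX^[i] g) (φ t, t ^ N)) 0 + (D * i : ℕ) := by
  have han := (hg.iterate_partialX i).comp_curve hφ h0 hN
  rw [← isBigO_mul_pow_iff han]
  obtain ⟨s, hsU, hs⟩ := hU.exists_subset_card_eq (w + i + 1)
  have hφt : Tendsto φ (𝓝 0) (𝓝 0) := by simpa [ContinuousAt, h0] using hφ.continuousAt
  let p : ℂ → Polynomial ℂ := fun t => ∑ k ∈ Finset.range (w + i + 1),
    Polynomial.monomial k ((partialX^[k] g) (φ t, t ^ N) * (t ^ D) ^ k / k.factorial)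
  have hpdeg : ∀ t, (p t).degree < (s.card : WithBot ℕ) := by
    intro t
    refine (Polynomial.degree_sum_le _ _).trans_lt ?_
    rw [Finset.sup_lt_iff (by rw [hs]; exact WithBot.bot_lt_coe _)]
    intro k hk
    refine (Polynomial.degree_monomial_le _ _).trans_lt ?_
    rw [hs]
    exact_mod_cast Finset.mem_range.1 hk
  have hcoeff : ∀ t, (p t).coeff i = (partialX^[i] g) (φ t, t ^ N) * (t ^ D) ^ i / i.factorial := by
    intro t
    simp only [p, Polynomial.finsetSum_coeff, Polynomial.coeff_monomial]
    rw [Finset.sum_ite_eq']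
    simp
  have hval : ∀ u ∈ s, (fun t => (p t).eval u) =O[𝓝 0] fun t : ℂ => t ^ w := by
    intro u hu
    have hδt : Tendsto (fun t : ℂ => u * t ^ D) (𝓝 0) (𝓝 0) := by
      have : ContinuousAt (fun t : ℂ => u * t ^ D) 0 := by fun_prop
      simpa [ContinuousAt, hD] using this
    have hT := isBigO_taylor_along_curve hg hφt hδt hN (w + i + 1)
    have hrem : (fun t => (u * t ^ D) ^ (w + i + 1)) =O[𝓝 0] fun t : ℂ => t ^ w := by
      simp only [mul_pow, ← pow_mul]
      refine Asymptotics.IsBigO.const_mul_left ?_ _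
      exact isBigO_pow_pow_of_le (by nlinarith [Nat.pos_of_ne_zero hD])
    refine ((hw u (hsU hu)).sub (hT.trans hrem)).congr_left fun t => ?_
    simp only [p, Polynomial.eval_finsetSum, Polynomial.eval_monomial, sub_sub_cancel]
    refine Finset.sum_congr rfl fun k _ => ?_
    rw [mul_pow]
    ring
  have hinterp : ∀ t, (p t).coeff i =
      ∑ u ∈ s, (p t).eval u * (Lagrange.basis s id u).coeff i := by
    intro t
    conv_lhs => rw [Lagrange.eq_interpolate (s := s) (v := id) (Function.injective_id.injOn)
      (hpdeg t)]
    simp [Lagrange.interpolate_apply]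
  have hfin : (fun t => (p t).coeff i) =O[𝓝 0] fun t : ℂ => t ^ w := by
    simp only [hinterp]
    refine Asymptotics.IsBigO.fun_sum fun u hu => ?_
    simp only [mul_comm _ ((Lagrange.basis s id u).coeff i)]
    exact (hval u hu).const_mul_left _
  refine (hfin.const_mul_left (i.factorial : ℂ)).congr_left fun t => ?_
  have h2 : (i.factorial : ℂ) ≠ 0 := by exact_mod_cast i.factorial_ne_zero
  rw [hcoeff, pow_mul]
  field_simp

/-- Moving a curve by `δ = O(t ^ D)` can lower the order of `g` only down to that of a Taylor term
`g_k(φ) t ^ {D k}`. -/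
theorem exists_order_iterate_partialX_le {g : ℂ × ℂ → ℂ} (hg : AnalyticAt ℂ g 0) {φ δ : ℂ → ℂ}
    (hφ : AnalyticAt ℂ φ 0) (h0 : φ 0 = 0) (hδa : AnalyticAt ℂ δ 0) {N D : ℕ} (hN : N ≠ 0)
    (hD : D ≠ 0) (hδ : δ =O[𝓝 0] fun t : ℂ => t ^ D) {n : ℕ}
    (hn : analyticOrderAt (fun t => g (φ t + δ t, t ^ N)) 0 = n) :
    ∃ k, analyticOrderAt (fun t => (partialX^[k] g) (φ t, t ^ N)) 0 + (D * k : ℕ) ≤ n := by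
  by_contra! hlt
  have hle : ∀ k, ((n + 1 : ℕ) : ℕ∞) ≤
      analyticOrderAt (fun t => (partialX^[k] g) (φ t, t ^ N)) 0 + (D * k : ℕ) := by
    intro k
    exact_mod_cast Order.add_one_le_of_lt (hlt k)
  have hδ0 : δ 0 = 0 := hδ.eq_zero_imp.self_of_nhds (by simp [hD])
  have hdiff := isBigO_sub_along_curve hg hφ h0 hN hD hδ fun i _ => hle i
  have hbase := (isBigO_mul_pow_iff (hg.comp_curve hφ h0 hN) 0 (n + 1)).2 (by simpa using hle 0)
  have htot : (fun t => g (φ t + δ t, t ^ N)) =O[𝓝 0] fun t : ℂ => t ^ (n + 1) :=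
    (hdiff.add hbase).congr_left fun t => by simp
  have han := hg.comp_curve (hφ.add hδa) (by simp [h0, hδ0]) hN
  have := (natCast_le_analyticOrderAt_iff_isBigO han (n + 1)).2 htot
  have h2 : ((n + 1 : ℕ) : ℕ∞) ≤ n := this.trans hn.le
  exact absurd (Nat.cast_le.1 h2) (by omega)

/-- Moving a curve by `δ = O(t ^ D)` keeps the order of `g` if all higher Taylor terms have larger
order. -/
theorem order_add_eq_of_lt_order_iterate_partialX {g : ℂ × ℂ → ℂ} (hg : AnalyticAt ℂ g 0)
    {φ δ : ℂ → ℂ}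
    (hφ : AnalyticAt ℂ φ 0) (h0 : φ 0 = 0) (hδa : AnalyticAt ℂ δ 0) {N D : ℕ} (hN : N ≠ 0)
    (hD : D ≠ 0) (hδ : δ =O[𝓝 0] fun t : ℂ => t ^ D) {n : ℕ}
    (hn : analyticOrderAt (fun t => g (φ t, t ^ N)) 0 = n)
    (hlt : ∀ i, 1 ≤ i → (n : ℕ∞) <
      analyticOrderAt (fun t => (partialX^[i] g) (φ t, t ^ N)) 0 + (D * i : ℕ)) :
    analyticOrderAt (fun t => g (φ t + δ t, t ^ N)) 0 = n := by
  have hδ0 : δ 0 = 0 := hδ.eq_zero_imp.self_of_nhds (by simp [hD])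
  have hdiff := isBigO_sub_along_curve (w := n + 1) hg hφ h0 hN hD hδ fun i hi => by
    exact_mod_cast Order.add_one_le_of_lt (hlt i hi)
  have han := hg.comp_curve hφ h0 hN
  have han' := hg.comp_curve (hφ.add hδa) (by simp [h0, hδ0]) hN
  have hge := (natCast_le_analyticOrderAt_iff_isBigO (han'.sub han) (n + 1)).2 hdiff
  have := analyticOrderAt_add_eq_left_of_lt (f := fun t => g (φ t, t ^ N))
    (g := fun t => g ((φ + δ) t, t ^ N) - g (φ t, t ^ N)) (z₀ := 0) (by
      refine lt_of_lt_of_le ?_ hge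
      rw [hn]
      exact_mod_cast Nat.lt_succ_self n)
  rw [hn] at this
  rw [← this]
  congr 1
  funext t
  simp

/-- On a curve where `g_x` vanishes, the chain rule reads `d/dt g = N t ^ {N - 1} g_y`. -/
theorem order_eq_order_partialY_add {g : ℂ × ℂ → ℂ} (hg : AnalyticAt ℂ g 0) (hg0 : g 0 = 0)
    {φ : ℂ → ℂ} (hφ : AnalyticAt ℂ φ 0) (h0 : φ 0 = 0) {N : ℕ} (hN : N ≠ 0)
    (hx : ∀ᶠ t in 𝓝 (0 : ℂ), partialX g (φ t, t ^ N) = 0) :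
    analyticOrderAt (fun t => g (φ t, t ^ N)) 0 =
      analyticOrderAt (fun t => partialY g (φ t, t ^ N)) 0 + (N : ℕ∞) := by
  have han := hg.comp_curve hφ h0 hN
  have hany := hg.partialY.comp_curve hφ h0 hN
  have hd := han.analyticOrderAt_deriv_add_one
  simp only [h0, zero_pow hN, Prod.mk_zero_zero, hg0, sub_zero] at hd
  have hpar : Tendsto (fun t => (φ t, t ^ N)) (𝓝 0) (𝓝 (0 : ℂ × ℂ)) := by
    have : ContinuousAt (fun t : ℂ => (φ t, t ^ N)) 0 :=
      hφ.continuousAt.prodMk (by fun_prop)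
    simpa [ContinuousAt, h0, hN, Prod.mk_zero_zero] using this
  have hderiv : deriv (fun t => g (φ t, t ^ N)) =ᶠ[𝓝 0]
      (fun t => partialY g (φ t, t ^ N)) * ((fun _ => (N : ℂ)) * fun t => t ^ (N - 1)) := by
    filter_upwards [hx, hφ.eventually_analyticAt, hpar.eventually hg.eventually_analyticAt,
      hpar.eventually (partialX_eventuallyEq_fderiv hg),
      hpar.eventually (partialY_eventuallyEq_fderiv hg)] with t h1 h2 h3 h4 h5
    have hc : HasDerivAt (fun t : ℂ => (φ t, t ^ N)) (deriv φ t, (N : ℂ) * t ^ (N - 1)) t :=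
      h2.differentiableAt.hasDerivAt.prodMk (hasDerivAt_pow N t)
    have hF := (h3.differentiableAt.hasFDerivAt (𝕜 := ℂ)).comp_hasDerivAt t hc
    have hsplit : ((deriv φ t, (N : ℂ) * t ^ (N - 1)) : ℂ × ℂ) =
        deriv φ t • ((1 : ℂ), (0 : ℂ)) + ((N : ℂ) * t ^ (N - 1)) • ((0 : ℂ), (1 : ℂ)) := by
      simp
    have := hF.deriv
    rw [hsplit, map_add, map_smul, map_smul, ← h4, ← h5, h1] at this
    simp only [Function.comp_def] at this
    rw [this]
    simp [mul_comm]
  have hconst : analyticOrderAt (fun _ : ℂ => (N : ℂ)) 0 = 0 := by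
    rw [analyticAt_const.analyticOrderAt_eq_zero]
    exact_mod_cast hN
  have hpw : AnalyticAt ℂ (fun t : ℂ => t ^ (N - 1)) 0 := by fun_prop
  rw [analyticOrderAt_congr hderiv, analyticOrderAt_mul hany (analyticAt_const.mul hpw),
    analyticOrderAt_mul analyticAt_const hpw, hconst, analyticOrderAt_pow_zero, zero_add,
    add_assoc] at hd
  rw [← hd]
  congr 1
  exact_mod_cast Nat.succ_pred_eq_of_ne_zero hN

/-! ### Fractional orders and Puiseux arcs -/

theorem fracOrd_of_order_eq_top {N : ℕ} {a : ℂ → ℂ} (h : analyticOrderAt a 0 = ⊤) :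
    fracOrd N a = ⊤ := by
  rw [fracOrd, h]
  rfl

theorem fracOrd_of_order_eq_coe {N n : ℕ} {a : ℂ → ℂ} (h : analyticOrderAt a 0 = n) :
    fracOrd N a = ((n / N : ℚ) : WithTop ℚ) := by
  rw [fracOrd, h]
  rfl

theorem fracOrd_eq_coe_iff {N : ℕ} {a : ℂ → ℂ} {q : ℚ} :
    fracOrd N a = q ↔ ∃ n : ℕ, analyticOrderAt a 0 = n ∧ (n : ℚ) / N = q := by
  cases h : analyticOrderAt a 0 with
  | top => simp [fracOrd_of_order_eq_top h]
  | coe n => simp [fracOrd_of_order_eq_coe h]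

theorem coe_div_le_fracOrd {N : ℕ} (hN : N ≠ 0) {a : ℂ → ℂ} {w : ℕ} :
    (((w : ℚ) / N : ℚ) : WithTop ℚ) ≤ fracOrd N a ↔ (w : ℕ∞) ≤ analyticOrderAt a 0 := by
  have hN' : (0 : ℚ) < N := by exact_mod_cast Nat.pos_of_ne_zero hN
  cases h : analyticOrderAt a 0 with
  | top => simp [fracOrd_of_order_eq_top h]
  | coe n =>
    rw [fracOrd_of_order_eq_coe h, WithTop.coe_le_coe, div_le_div_iff_of_pos_right hN']
    simp

theorem fracOrd_mul {N k : ℕ} (hk : k ≠ 0) {a b : ℂ → ℂ}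
    (h : analyticOrderAt b 0 = analyticOrderAt a 0 * k) : fracOrd (N * k) b = fracOrd N a := by
  have hk' : (k : ℚ) ≠ 0 := by exact_mod_cast hk
  cases ha : analyticOrderAt a 0 with
  | top =>
    rw [ha, ENat.top_mul (by exact_mod_cast hk)] at h
    rw [fracOrd_of_order_eq_top h, fracOrd_of_order_eq_top ha]
  | coe n =>
    rw [ha] at h
    rw [fracOrd_of_order_eq_coe (n := n * k) (by exact_mod_cast h), fracOrd_of_order_eq_coe ha]
    push_cast
    rw [mul_div_mul_right _ _ hk']

theorem natCast_toNat_num {d : ℚ} (hd : 0 ≤ d) : (d.num.toNat : ℚ) = d.den * d := by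
  have h1 : ((d.num.toNat : ℤ) : ℚ) = d.num := by
    rw [Int.toNat_of_nonneg (Rat.num_nonneg.2 hd)]
  rw [← Rat.den_mul_eq_num] at h1
  exact_mod_cast h1

namespace PuiseuxArc

theorem fn_zero_eq_zero_of_pos_ord {η : PuiseuxArc} (h : 0 < η.ord) : η.fn 0 = 0 := by
  apply apply_eq_zero_of_analyticOrderAt_ne_zero
  intro h0
  have h1 := fracOrd_of_order_eq_coe (N := η.ram) (n := 0) (a := η.fn) (by simpa using h0)
  rw [ord, h1] at h
  simp at h

/-- Orders along `η` may be computed after the substitution `t ↦ t ^ k`. -/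
theorem ordAlong_eq_fracOrd_pow (η : PuiseuxArc) (h0 : η.fn 0 = 0) {g : ℂ × ℂ → ℂ}
    (hg : AnalyticAt ℂ g 0) {k R : ℕ} (hk : k ≠ 0) (hR : η.ram * k = R) :
    ordAlong g η = fracOrd R (fun t => g (η.fn (t ^ k), t ^ R)) := by
  subst hR
  refine (fracOrd_mul hk ?_).symm
  refine Eq.trans ?_ (analyticOrderAt_comp_pow
    (hg.comp_curve η.analyticAt_fn h0 η.ram_pos.ne') hk)
  simp only [← pow_mul, mul_comm k]

end PuiseuxArc

/-- Arcs with the same curve germ differ only by the choice of the root `y ^ {1/N}`, so all orders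
along them agree: near `0` every point of one parametrization is a point of the other at one of
finitely many arguments, and one choice works for infinitely many points, hence identically. -/
theorem ordAlong_eq_of_curveGerm_eq {α β : PuiseuxArc} (hα : α.fn 0 = 0) (hβ : β.fn 0 = 0)
    (h : α.curveGerm = β.curveGerm) {g : ℂ × ℂ → ℂ} (hg : AnalyticAt ℂ g 0) :
    ordAlong g β = ordAlong g α := by
  set M := α.ram with hM
  set N := β.ram with hN
  have hM0 : M ≠ 0 := α.ram_pos.ne'
  have hN0 : N ≠ 0 := β.ram_pos.ne'
  have hev : ∀ᶠ p in 𝓝 (0 : ℂ × ℂ), (∃ t, α.par t = p) = ∃ t, β.par t = p :=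
    Germ.coe_eq.1 h
  have hβM : AnalyticAt ℂ (fun τ : ℂ => β.fn (τ ^ M)) 0 :=
    AnalyticAt.fun_comp (by simpa [hM0] using β.analyticAt_fn) (by fun_prop)
  have hpar : Tendsto (fun τ : ℂ => β.par (τ ^ M)) (𝓝 0) (𝓝 0) := by
    have : ContinuousAt (fun τ : ℂ => (β.fn (τ ^ M), (τ ^ M) ^ N)) 0 :=
      hβM.continuousAt.prodMk (by fun_prop)
    simpa [ContinuousAt, PuiseuxArc.par, hβ, hM0, hN0, Prod.mk_zero_zero] using this
  have hroot : ∀ᶠ τ in 𝓝[≠] (0 : ℂ), ∃ ζ ∈ Polynomial.nthRootsFinset M (1 : ℂ),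
      β.fn (τ ^ M) = α.fn (ζ * τ ^ N) := by
    filter_upwards [(hpar.eventually hev).filter_mono nhdsWithin_le_nhds,
      eventually_mem_nhdsWithin] with τ h1 h2
    obtain ⟨t, ht⟩ : ∃ t, α.par t = β.par (τ ^ M) := by rw [h1]; exact ⟨_, rfl⟩
    simp only [PuiseuxArc.par, Prod.mk.injEq] at ht
    have hτ : τ ^ N ≠ 0 := pow_ne_zero _ h2
    refine ⟨t / τ ^ N, ?_, ?_⟩
    · rw [Polynomial.mem_nthRootsFinset (Nat.pos_of_ne_zero hM0), div_pow, ht.2, ← pow_mul,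
        ← pow_mul, mul_comm M N, div_self (pow_ne_zero _ h2)]
    · rw [div_mul_cancel₀ _ hτ, ht.1]
  obtain ⟨ζ, hζ, hfreq⟩ : ∃ ζ ∈ Polynomial.nthRootsFinset M (1 : ℂ),
      ∃ᶠ τ in 𝓝[≠] (0 : ℂ), β.fn (τ ^ M) = α.fn (ζ * τ ^ N) := by
    by_contra! hno
    obtain ⟨τ, h1, ζ, hζ, h2⟩ :=
      (((Finset.eventually_all _).2 hno).and hroot).exists
    exact h1 ζ hζ h2
  rw [Polynomial.mem_nthRootsFinset (Nat.pos_of_ne_zero hM0)] at hζ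
  have hζ0 : ζ ≠ 0 := by
    rintro rfl
    simp [hM0] at hζ
  have hαN : AnalyticAt ℂ (fun τ : ℂ => α.fn (ζ * τ ^ N)) 0 :=
    AnalyticAt.fun_comp (by simpa [hN0] using α.analyticAt_fn) (by fun_prop)
  have heq := (hβM.frequently_eq_iff_eventually_eq hαN).1 hfreq
  have hA := hg.comp_curve α.analyticAt_fn hα hM0
  have hderiv : deriv (fun t : ℂ => ζ * t) 0 ≠ 0 := by simpa using hζ0
  have hrot := analyticOrderAt_comp_of_deriv_ne_zero (f := fun t => g (α.fn t, t ^ M))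
    (g := fun t : ℂ => ζ * t) (z₀ := 0) (by fun_prop) hderiv
  have hrotA : AnalyticAt ℂ (fun t => g (α.fn (ζ * t), (ζ * t) ^ M)) 0 :=
    AnalyticAt.fun_comp (g := fun t => g (α.fn t, t ^ M)) (by simpa using hA) (by fun_prop)
  rw [β.ordAlong_eq_fracOrd_pow hβ hg hM0 (mul_comm N M)]
  refine fracOrd_mul hN0 ?_
  rw [mul_zero] at hrot
  change _ = analyticOrderAt (fun t => g (α.fn t, t ^ M)) 0 * _
  rw [← hrot]
  change _ = analyticOrderAt (fun t => g (α.fn (ζ * t), (ζ * t) ^ M)) 0 * _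
  rw [← analyticOrderAt_comp_pow hrotA hN0]
  refine analyticOrderAt_congr ?_
  filter_upwards [heq] with τ hτ
  rw [hτ, mul_pow, hζ, one_mul, ← pow_mul, mul_comm N M]

/-- Two arcs `γ` and `α = γ + u y ^ d + ⋯` over a common ramification `R` which also clears the
denominator of `d`, so that `y ^ d = t ^ D`. -/
theorem exists_common_ramification {γ α : PuiseuxArc} {u : ℂ} {d : ℚ} (hd : 0 < d)
    (hγ : γ.fn 0 = 0) (hα : (d : WithTop ℚ) < (α.sub (γ.addMonomial u d)).ord) :
    α.fn 0 = 0 ∧ ∃ (R D : ℕ) (φ δ : ℂ → ℂ), R ≠ 0 ∧ D ≠ 0 ∧ (D : ℚ) = R * d ∧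
      AnalyticAt ℂ φ 0 ∧ φ 0 = 0 ∧ AnalyticAt ℂ δ 0 ∧ (δ =O[𝓝 0] fun t : ℂ => t ^ D) ∧
      ∀ g : ℂ × ℂ → ℂ, AnalyticAt ℂ g 0 →
        ordAlong g γ = fracOrd R (fun t => g (φ t, t ^ R)) ∧
        ordAlong g α = fracOrd R (fun t => g (φ t + δ t, t ^ R)) := by
  set A := α.ram with hA
  set N := γ.ram with hN
  set m := d.num.toNat with hm
  have hA0 : A ≠ 0 := α.ram_pos.ne'
  have hN0 : N ≠ 0 := γ.ram_pos.ne'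
  have hden : d.den ≠ 0 := d.den_ne_zero
  have hmd : (m : ℚ) = d.den * d := natCast_toNat_num hd.le
  have hm0 : m ≠ 0 := by simpa [hm] using hd
  set σ := α.sub (γ.addMonomial u d) with hσ
  have hσram : σ.ram = A * (N * d.den) := rfl
  have hσfn : ∀ t, σ.fn t = α.fn (t ^ (N * d.den)) -
      (γ.fn ((t ^ A) ^ d.den) + u * (t ^ A) ^ (N * m)) := fun t => rfl
  have hR0 : A * (N * d.den) ≠ 0 := mul_ne_zero hA0 (mul_ne_zero hN0 hden)
  have hDR : ((A * N * m : ℕ) : ℚ) = (A * (N * d.den) : ℕ) * d := by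
    push_cast
    rw [hmd]
    ring
  have hσ0 : σ.fn 0 = 0 :=
    σ.fn_zero_eq_zero_of_pos_ord (lt_trans (by exact_mod_cast hd) hα)
  have hα0 : α.fn 0 = 0 := by
    have := hσfn 0
    rw [hσ0] at this
    simpa [hA0, hN0, hden, hm0, hγ] using this.symm
  refine ⟨hα0, A * (N * d.den), A * N * m, fun t => γ.fn (t ^ (A * d.den)),
    fun t => α.fn (t ^ (N * d.den)) - γ.fn (t ^ (A * d.den)), hR0,
    mul_ne_zero (mul_ne_zero hA0 hN0) hm0, hDR, ?_, ?_, ?_, ?_, ?_⟩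
  · exact AnalyticAt.fun_comp (by simpa [hA0, hden] using γ.analyticAt_fn) (by fun_prop)
  · simp [hA0, hden, hγ]
  · exact (AnalyticAt.fun_comp (by simpa [hN0, hden] using α.analyticAt_fn) (by fun_prop)).sub
      (AnalyticAt.fun_comp (by simpa [hA0, hden] using γ.analyticAt_fn) (by fun_prop))
  · have h1 : ((A * N * m : ℕ) : ℕ∞) ≤ analyticOrderAt σ.fn 0 := by
      rw [← coe_div_le_fracOrd hR0, hDR, mul_div_cancel_left₀ _ (by exact_mod_cast hR0)]
      exact hα.le
    rw [natCast_le_analyticOrderAt_iff_isBigO σ.analyticAt_fn] at h1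
    have h2 : (fun t : ℂ => u * t ^ (A * N * m)) =O[𝓝 0] fun t : ℂ => t ^ (A * N * m) :=
      (Asymptotics.isBigO_refl _ _).const_mul_left u
    refine (h1.add h2).congr_left fun t => ?_
    rw [hσfn, ← pow_mul, ← pow_mul, ← mul_assoc A N m]
    ring
  · intro g hg
    constructor
    · exact γ.ordAlong_eq_fracOrd_pow hγ hg (mul_ne_zero hA0 hden) (by ring)
    · simp only [add_sub_cancel]
      exact α.ordAlong_eq_fracOrd_pow hα0 hg (mul_ne_zero hN0 hden) rfl

/-! ### Arcs in a gradient canyon -/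

theorem IsPolarArc.fn_zero {f : ℂ × ℂ → ℂ} {γ : PuiseuxArc} (hγ : IsPolarArc f γ) : γ.fn 0 = 0 :=
  PuiseuxArc.fn_zero_eq_zero_of_pos_ord (lt_of_lt_of_le (by simp) hγ.1)

theorem IsPolarArc.ordAlong_partialX {f : ℂ × ℂ → ℂ} {γ : PuiseuxArc} (hγ : IsPolarArc f γ) :
    ordAlong (partialX f) γ = ⊤ :=
  fracOrd_of_order_eq_top (analyticOrderAt_eq_top.2 hγ.2.2)

theorem IsPolarArc.ordAlong_eq_polarHeight {f : ℂ × ℂ → ℂ} {γ : PuiseuxArc}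
    (hγ : IsPolarArc f γ) : ordAlong f γ = polarHeight f γ := by
  cases h : analyticOrderAt (fun t => f (γ.par t)) 0 with
  | top => exact absurd (analyticOrderAt_eq_top.1 h) hγ.2.1
  | coe n => rw [polarHeight, ordAlong, fracOrd_of_order_eq_coe h, WithTop.untopD_coe]

/-- For a polar arc `γ` of gradient degree `d`, every Newton dot `(i, e)` of `f_x` along `γ` lies
on or above the line of slope `-d` through `(0, h - 1)`: along `γ` the gradient has order
`h - 1`, so for generic `u` the order of `f_x` along `γ + u y ^ d` is at least `h - 1`. -/
theorem polarHeight_sub_one_le {f : ℂ × ℂ → ℂ} (hf : AnalyticAt ℂ f 0) (hf0 : f 0 = 0)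
    {γ : PuiseuxArc} (hγ : IsPolarArc f γ) {d : ℚ} (hd : IsGradientDegree f γ d) {i : ℕ} {e : ℚ}
    (he : ordAlong (partialX^[i] (partialX f)) γ = e) :
    polarHeight f γ - 1 ≤ e + d * i := by
  obtain ⟨hd0, hgen⟩ := hd.1
  have hφ0 := hγ.fn_zero
  have hh := hγ.ordAlong_eq_polarHeight
  set m := d.num.toNat with hm
  have hN0 : γ.ram ≠ 0 := γ.ram_pos.ne'
  have hden : d.den ≠ 0 := d.den_ne_zero
  have hmd : (m : ℚ) = d.den * d := natCast_toNat_num hd0.le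
  have hm0 : m ≠ 0 := by simpa [hm] using hd0
  set R := γ.ram * d.den with hR
  have hR0 : R ≠ 0 := mul_ne_zero hN0 hden
  have hRq : (0 : ℚ) < R := by exact_mod_cast Nat.pos_of_ne_zero hR0
  set φ : ℂ → ℂ := fun t => γ.fn (t ^ d.den) with hφ
  have hφa : AnalyticAt ℂ φ 0 :=
    AnalyticAt.fun_comp (by simpa [hden] using γ.analyticAt_fn) (by fun_prop)
  have hφz : φ 0 = 0 := by simp [hφ, hden, hφ0]
  have hord : ∀ {g : ℂ × ℂ → ℂ}, AnalyticAt ℂ g 0 →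
      ordAlong g γ = fracOrd R (fun t => g (φ t, t ^ R)) := fun hg =>
    γ.ordAlong_eq_fracOrd_pow hφ0 hg hden rfl
  -- the height and the order of the gradient, over the ramification `R`
  rw [hord hf] at hh
  obtain ⟨n, hn, hnh⟩ := fracOrd_eq_coe_iff.1 hh
  have hx : ∀ᶠ t in 𝓝 (0 : ℂ), partialX f (φ t, t ^ R) = 0 := by
    have := hγ.ordAlong_partialX
    rw [hord hf.partialX] at this
    apply analyticOrderAt_eq_top.1
    by_contra hne
    obtain ⟨k, hk⟩ := ENat.ne_top_iff_exists.1 hne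
    rw [fracOrd_of_order_eq_coe hk.symm] at this
    exact WithTop.coe_ne_top this
  have hy := order_eq_order_partialY_add hf hf0 hφa hφz hR0 hx
  rw [hn] at hy
  obtain ⟨k, hk⟩ : ∃ k : ℕ, analyticOrderAt (fun t => partialY f (φ t, t ^ R)) 0 = k := by
    cases h : analyticOrderAt (fun t => partialY f (φ t, t ^ R)) 0 with
    | top =>
      rw [h, top_add] at hy
      exact absurd hy (ENat.natCast_ne_top n)
    | coe k => exact ⟨k, rfl⟩
  have hnk : n = k + R := by
    rw [hk] at hy
    exact_mod_cast hy
  have hgrad : gradOrdAlong f γ = (((k : ℚ) / R : ℚ) : WithTop ℚ) := by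
    rw [gradOrdAlong, hγ.ordAlong_partialX, min_eq_right le_top, hord hf.partialY,
      fracOrd_of_order_eq_coe hk]
  have hU : {u : ℂ | gradOrdAlong f γ = gradOrdAlong f (γ.addMonomial u d)}.Infinite := by
    intro hfin
    have h1 := hfin.compl_mem_cofinite
    have h2 : (∅ : Set ℂ) ∈ (cofinite : Filter ℂ) := by
      filter_upwards [h1, hgen] with u hu hu' using hu hu'
    exact (cofinite_neBot (α := ℂ)).ne (empty_mem_iff_bot.1 h2)
  have hkey := le_order_iterate_partialX_of_infinite (w := k) (D := γ.ram * m) hf.partialX hφa hφz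
    hR0 (mul_ne_zero hN0 hm0) hU (fun u hu => by
      have hle : (((k : ℚ) / R : ℚ) : WithTop ℚ) ≤
          fracOrd R (fun t => partialX f (φ t + u * t ^ (γ.ram * m), t ^ R)) := by
        rw [← hgrad, show gradOrdAlong f γ = _ from hu]
        exact min_le_left _ _
      rw [coe_div_le_fracOrd hR0] at hle
      refine (natCast_le_analyticOrderAt_iff_isBigO ?_ k).1 hle
      exact hf.partialX.comp_curve (hφa.add (by fun_prop)) (by simp [hφz, hN0, hm0]) hR0) i
  rw [hord (hf.partialX.iterate_partialX i)] at he
  obtain ⟨l, hl, hle⟩ := fracOrd_eq_coe_iff.1 he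
  rw [hl] at hkey
  have hkl : (k : ℚ) ≤ l + γ.ram * m * i := by exact_mod_cast hkey
  rw [← hnh, ← hle, hnk]
  have hm' : (γ.ram : ℚ) * m = R * d := by
    rw [hmd, hR]
    push_cast
    ring
  rw [hm'] at hkl
  have e1 : (((k + R : ℕ) : ℚ)) / R - 1 = k / R := by
    push_cast
    field_simp
    ring
  have e2 : (l : ℚ) / R + d * i = (l + R * d * i) / R := by
    field_simp
  rw [e1, e2]
  gcongr

/-- Every Newton dot of `g` along `β` lies on or above a line of slope `-d` drawn to the left from
a Newton dot of `g` along `γ`. Only the lowest dot of each column is considered, at height the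
order of `∂ⁱg/∂xⁱ` along the arc. -/
def NewtonDominates (g : ℂ × ℂ → ℂ) (d : ℚ) (γ β : PuiseuxArc) : Prop :=
  ∀ (i : ℕ) (e : ℚ), ordAlong (partialX^[i] g) β = e →
    ∃ (k : ℕ) (e' : ℚ), ordAlong (partialX^[i + k] g) γ = e' ∧ e' + d * k ≤ e

theorem exists_fracOrd_iterate_partialX_le {g : ℂ × ℂ → ℂ} (hg : AnalyticAt ℂ g 0) {φ δ : ℂ → ℂ}
    (hφ : AnalyticAt ℂ φ 0) (h0 : φ 0 = 0) (hδa : AnalyticAt ℂ δ 0) {R D : ℕ} (hR : R ≠ 0)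
    (hD : D ≠ 0) (hδ : δ =O[𝓝 0] fun t : ℂ => t ^ D) {d : ℚ} (hDR : (D : ℚ) = R * d)
    {i : ℕ} {e : ℚ} (he : fracOrd R (fun t => (partialX^[i] g) (φ t + δ t, t ^ R)) = e) :
    ∃ (k : ℕ) (e' : ℚ), fracOrd R (fun t => (partialX^[i + k] g) (φ t, t ^ R)) = e' ∧
      e' + d * k ≤ e := by
  obtain ⟨n, hn, rfl⟩ := fracOrd_eq_coe_iff.1 he
  obtain ⟨k, hk⟩ := exists_order_iterate_partialX_le (hg.iterate_partialX i) hφ h0 hδa hR hD hδ hn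
  rw [← Function.iterate_add_apply, add_comm k i] at hk
  cases hl : analyticOrderAt (fun t => (partialX^[i + k] g) (φ t, t ^ R)) 0 with
  | top => simp [hl] at hk
  | coe l =>
    refine ⟨k, l / R, fracOrd_of_order_eq_coe hl, ?_⟩
    rw [hl] at hk
    have hk' : (l : ℚ) + D * k ≤ n := by exact_mod_cast hk
    have hRq : (0 : ℚ) < R := by exact_mod_cast Nat.pos_of_ne_zero hR
    rw [show (l : ℚ) / R + d * k = (l + D * k) / R by rw [hDR]; field_simp]
    gcongr

/-- A polar arc `β` in the canyon of `γ` is, up to the choice of the root of `y`, of the form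
`γ + O(y ^ d)`, so Newton dots along either arc are dominated by those along the other. Its height
is that of `γ`, because `f(β) - f(γ)` has order at least `h - 1 + d`, which exceeds `h`. -/
theorem polarHeight_eq_and_newtonDominates {f : ℂ × ℂ → ℂ} (hf : AnalyticAt ℂ f 0)
    (hf0 : f 0 = 0) {γ β : PuiseuxArc} (hγ : IsPolarArc f γ) (hβ : IsPolarArc f β) {d : ℚ}
    (hd : IsGradientDegree f γ d) (hd1 : 1 < d) (hmem : β.curveGerm ∈ canyonOf γ d) :
    polarHeight f β = polarHeight f γ ∧ NewtonDominates (partialX f) d γ β ∧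
      NewtonDominates (partialX f) d β γ := by
  obtain ⟨α, u, hα, hαβ⟩ := hmem
  obtain ⟨hα0, R, D, φ, δ, hR, hD, hDR, hφ, hφ0, hδa, hδ, hord⟩ :=
    exists_common_ramification (by linarith) hγ.fn_zero hα
  have hβα : ∀ {g : ℂ × ℂ → ℂ}, AnalyticAt ℂ g 0 →
      ordAlong g β = fracOrd R (fun t => g (φ t + δ t, t ^ R)) := fun hg => by
    rw [ordAlong_eq_of_curveGerm_eq hα0 hβ.fn_zero hαβ hg, (hord _ hg).2]
  have hγφ : ∀ {g : ℂ × ℂ → ℂ}, AnalyticAt ℂ g 0 →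
      ordAlong g γ = fracOrd R (fun t => g (φ t, t ^ R)) := fun hg => (hord _ hg).1
  have hRq : (0 : ℚ) < R := by exact_mod_cast Nat.pos_of_ne_zero hR
  have hδ0 : δ 0 = 0 := hδ.eq_zero_imp.self_of_nhds (by simp [hD])
  refine ⟨?_, ?_, ?_⟩
  · have hh := hγ.ordAlong_eq_polarHeight
    rw [hγφ hf] at hh
    obtain ⟨n, hn, hnh⟩ := fracOrd_eq_coe_iff.1 hh
    have := order_add_eq_of_lt_order_iterate_partialX hf hφ hφ0 hδa hR hD hδ hn (by
      intro i hi
      obtain ⟨i, rfl⟩ := Nat.exists_eq_add_of_le' hi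
      rw [Function.iterate_succ_apply]
      cases hl : analyticOrderAt (fun t => (partialX^[i] (partialX f)) (φ t, t ^ R)) 0 with
      | top => simp
      | coe l =>
        have hle := polarHeight_sub_one_le hf hf0 hγ hd (i := i) (e := l / R) (by
          rw [hγφ (hf.partialX.iterate_partialX i), fracOrd_of_order_eq_coe hl])
        -- the extra factor `δ` raises the order by `d > 1`, which beats the `1` in `h - 1`
        have h1 : (n : ℚ) / R < (l + D * (i + 1)) / R := by
          rw [hDR, show ((l : ℚ) + R * d * (i + 1)) / R = l / R + d * i + d by field_simp; ring]
          linarith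
        rw [div_lt_div_iff_of_pos_right hRq] at h1
        exact_mod_cast h1)
    have h2 : ordAlong f β = polarHeight f γ := by
      rw [hβα hf, fracOrd_of_order_eq_coe this, hnh]
    rw [hβ.ordAlong_eq_polarHeight] at h2
    exact_mod_cast h2
  · intro i e he
    rw [hβα (hf.partialX.iterate_partialX i)] at he
    obtain ⟨k, e', h1, h2⟩ :=
      exists_fracOrd_iterate_partialX_le hf.partialX hφ hφ0 hδa hR hD hδ hDR he
    exact ⟨k, e', by rw [hγφ (hf.partialX.iterate_partialX _), h1], h2⟩
  · intro i e he
    rw [hγφ (hf.partialX.iterate_partialX i)] at he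
    obtain ⟨k, e', h1, h2⟩ := exists_fracOrd_iterate_partialX_le (δ := -δ) hf.partialX
      (hφ.add hδa) (by simp [hφ0, hδ0]) hδa.neg hR hD hδ.neg_left hDR (i := i) (e := e)
      (by simpa using he)
    exact ⟨k, e', by rw [hβα (hf.partialX.iterate_partialX _)]; exact h1, h2⟩

/-! ### The augmented Newton polygon -/

/-- The union of the quadrants `(i, j) + ℝ≥0²` over the Newton dots `(i, j)` is the union of those
over the lowest dot of each column, which lies at height the order of the coefficient of `X ^ i`. -/
theorem newtonDots_quadrants_eq {g : ℂ × ℂ → ℂ} (hg : AnalyticAt ℂ g 0) {η : PuiseuxArc}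
    (h0 : η.fn 0 = 0) :
    {p : ℝ × ℝ | ∃ e ∈ newtonDots g η, ∃ u v : ℝ, 0 ≤ u ∧ 0 ≤ v ∧ p = (e.1 + u, e.2 + v)} =
      {p | ∃ i n : ℕ, analyticOrderAt (fun t => (partialX^[i] g) (η.par t)) 0 = n ∧
        (i : ℝ) ≤ p.1 ∧ (n : ℝ) / η.ram ≤ p.2} := by
  have hram : (0 : ℝ) < η.ram := by exact_mod_cast η.ram_pos
  have hcoeff : ∀ i j, relCoeff g η i j ≠ 0 ↔
      iteratedDeriv j (fun t => (partialX^[i] g) (η.par t)) 0 ≠ 0 := by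
    intro i j
    have h1 : (i.factorial : ℂ) ≠ 0 := by exact_mod_cast i.factorial_ne_zero
    have h2 : (j.factorial : ℂ) ≠ 0 := by exact_mod_cast j.factorial_ne_zero
    rw [relCoeff]
    simp only [iteratedDeriv_eq_iterate_partialX, div_eq_mul_inv, iteratedDeriv_mul_const_field]
    simp [h1, h2, PuiseuxArc.par]
  have han : ∀ i, AnalyticAt ℂ (fun t => (partialX^[i] g) (η.par t)) 0 := fun i =>
    (hg.iterate_partialX i).comp_curve η.analyticAt_fn h0 η.ram_pos.ne'
  ext ⟨x, y⟩
  constructor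
  · rintro ⟨_, ⟨i, j, hij, rfl⟩, u, v, hu, hv, hp⟩
    simp only [Prod.mk.injEq] at hp
    rw [hcoeff] at hij
    cases hn : analyticOrderAt (fun t => (partialX^[i] g) (η.par t)) 0 with
    | top =>
      exact absurd ((natCast_le_analyticOrderAt_iff_iteratedDeriv_eq_zero (n := j + 1) (han i)).1
        (by simp [hn]) j (Nat.lt_succ_self j)) hij
    | coe n =>
      have hnj : n ≤ j := by
        by_contra hlt
        exact hij ((natCast_le_analyticOrderAt_iff_iteratedDeriv_eq_zero (n := n) (han i)).1
          (by simp [hn]) j (by omega))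
      have : (n : ℝ) / η.ram ≤ j / η.ram := by gcongr
      exact ⟨i, n, hn, by simp only; linarith, by simp only; linarith⟩
  · rintro ⟨i, n, hn, h1, h2⟩
    have h3 := ((analyticOrderAt_eq_nat_iff_iteratedDeriv_eq_zero (han i)).1 hn).2
    exact ⟨_, ⟨i, n, (hcoeff i n).2 h3, rfl⟩, x - i, y - n / η.ram, by simpa using h1,
      by simpa using h2, by simp⟩

open scoped Pointwise in
/-- By Dickson's lemma finitely many of the quadrants suffice, so their convex hull is the sum of a
compact set and a closed one. -/
theorem isClosed_convexHull_quadrants (T : Set (ℕ × ℕ)) {N : ℕ} (hN : 0 < N) :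
    IsClosed (convexHull ℝ {p : ℝ × ℝ | ∃ i n : ℕ, (i, n) ∈ T ∧ (i : ℝ) ≤ p.1 ∧
      (n : ℝ) / N ≤ p.2}) := by
  have hN' : (0 : ℝ) < N := by exact_mod_cast hN
  have hfin : {x | Minimal (· ∈ T) x}.Finite :=
    WellQuasiOrderedLE.finite_of_isAntichain (setOfPred_minimal_antichain _)
  set F : Set (ℝ × ℝ) := (fun x : ℕ × ℕ => ((x.1 : ℝ), (x.2 : ℝ) / N)) '' {x | Minimal (· ∈ T) x}
    with hF
  have heq : {p : ℝ × ℝ | ∃ i n : ℕ, (i, n) ∈ T ∧ (i : ℝ) ≤ p.1 ∧ (n : ℝ) / N ≤ p.2} =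
      F + Set.Ici (0 : ℝ × ℝ) := by
    ext p
    rw [Set.mem_add]
    constructor
    · rintro ⟨i, n, hT, h1, h2⟩
      obtain ⟨x, hx, hmin⟩ := exists_minimal_le_of_wellFoundedLT (· ∈ T) (i, n) hT
      have h3 : (x.1 : ℝ) ≤ i := by exact_mod_cast hx.1
      have h4 : (x.2 : ℝ) ≤ n := by exact_mod_cast hx.2
      have h5 : (x.2 : ℝ) / N ≤ n / N := by gcongr
      refine ⟨_, ⟨x, hmin, rfl⟩, p - ((x.1 : ℝ), (x.2 : ℝ) / N), ?_, by simp⟩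
      rw [Set.mem_Ici, sub_nonneg]
      exact ⟨h3.trans h1, h5.trans h2⟩
    · rintro ⟨_, ⟨x, hx, rfl⟩, q, hq, rfl⟩
      exact ⟨x.1, x.2, hx.1, by simpa using hq.1, by simpa using hq.2⟩
  rw [heq, convexHull_add (R := ℝ), (convex_Ici (𝕜 := ℝ) (0 : ℝ × ℝ)).convexHull_eq]
  exact (isClosed_Ici).add_left_of_isCompact ((hfin.image _).isCompact_convexHull (𝕜 := ℝ))

/-- A closed convex subset of the first quadrant is the convex hull of its boundary: an
antidiagonal through one of its points meets it in a segment with end points on the boundary. -/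
theorem subset_convexHull_frontier {K : Set (ℝ × ℝ)} (hK : IsClosed K) (hK0 : K ⊆ Set.Ici 0) :
    K ⊆ convexHull ℝ (frontier K) := by
  -- going from `p` in the direction `v`, the last point of `K` lies on the boundary
  have key : ∀ v : ℝ × ℝ, (v = (1, -1) ∨ v = (-1, 1)) → ∀ p ∈ K,
      ∃ s : ℝ, 0 ≤ s ∧ p + s • v ∈ frontier K := by
    intro v hv p hp
    set S : Set ℝ := (fun s : ℝ => p + s • v) ⁻¹' K with hS
    have hcont : Continuous fun s : ℝ => p + s • v := by fun_prop
    have hSc : IsClosed S := hK.preimage hcont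
    have hS0 : (0 : ℝ) ∈ S := by simpa [hS] using hp
    have hSb : BddAbove S := by
      refine ⟨p.1 + p.2, fun s hs => ?_⟩
      have h1 := hK0 hp
      have h2 := hK0 hs
      have h11 : 0 ≤ p.1 := h1.1
      have h12 : 0 ≤ p.2 := h1.2
      have h21 : 0 ≤ p.1 + s * v.1 := h2.1
      have h22 : 0 ≤ p.2 + s * v.2 := h2.2
      rcases hv with rfl | rfl <;> simp only at h21 h22 <;> linarith
    refine ⟨sSup S, le_csSup hSb hS0, ?_⟩
    have hmem : sSup S ∈ S := hSc.csSup_mem ⟨0, hS0⟩ hSb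
    refine ⟨subset_closure hmem, fun hint => ?_⟩
    have hopen : (fun s : ℝ => p + s • v) ⁻¹' interior K ∈ 𝓝 (sSup S) :=
      (isOpen_interior.preimage hcont).mem_nhds hint
    obtain ⟨ε, hε, hball⟩ := Metric.mem_nhds_iff.1 hopen
    have h1 : sSup S + ε / 2 ∈ S := by
      apply interior_subset (s := K)
      apply hball
      rw [Metric.mem_ball, Real.dist_eq, add_sub_cancel_left, abs_of_pos (by positivity)]
      linarith
    linarith [le_csSup hSb h1]
  intro p hp
  obtain ⟨s, hs, h1⟩ := key (1, -1) (Or.inl rfl) p hp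
  obtain ⟨r, hr, h2⟩ := key (-1, 1) (Or.inr rfl) p hp
  rcases (add_nonneg hs hr).eq_or_lt with h0 | hpos
  · have : s = 0 := by linarith
    subst this
    exact subset_convexHull ℝ _ (by simpa using h1)
  · have h3 := (convex_convexHull ℝ (frontier K)) (subset_convexHull ℝ _ h1)
      (subset_convexHull ℝ _ h2) (a := r / (s + r)) (b := s / (s + r)) (by positivity)
      (by positivity) (by field_simp; ring)
    convert h3 using 1
    ext <;> simp <;> field_simp <;> ring

/-- The augmented Newton polygon as the convex hull of quadrants together with `(0, h - 1)`. -/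
theorem augmentedNewtonPolygon_eq {f : ℂ × ℂ → ℂ} (hf : AnalyticAt ℂ f 0) {γ : PuiseuxArc}
    (h0 : γ.fn 0 = 0) :
    augmentedNewtonPolygon f γ = convexHull ℝ
      ({p : ℝ × ℝ | ∃ (i : ℕ) (e : ℚ), ordAlong (partialX^[i] (partialX f)) γ = e ∧
        (i : ℝ) ≤ p.1 ∧ (e : ℝ) ≤ p.2} ∪ {((0 : ℝ), (polarHeight f γ : ℝ) - 1)}) := by
  have hU : {p : ℝ × ℝ | ∃ (i : ℕ) (e : ℚ), ordAlong (partialX^[i] (partialX f)) γ = e ∧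
      (i : ℝ) ≤ p.1 ∧ (e : ℝ) ≤ p.2} = {p | ∃ i n : ℕ,
        analyticOrderAt (fun t => (partialX^[i] (partialX f)) (γ.par t)) 0 = n ∧
        (i : ℝ) ≤ p.1 ∧ (n : ℝ) / γ.ram ≤ p.2} := by
    ext p
    constructor
    · rintro ⟨i, e, he, h1, h2⟩
      obtain ⟨n, hn, rfl⟩ := fracOrd_eq_coe_iff.1 he
      exact ⟨i, n, hn, h1, by push_cast at h2; exact h2⟩
    · rintro ⟨i, n, hn, h1, h2⟩
      exact ⟨i, n / γ.ram, fracOrd_of_order_eq_coe hn, h1, by push_cast; exact h2⟩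
  rw [augmentedNewtonPolygon, newtonPolygon, newtonDots_quadrants_eq hf.partialX h0, hU]
  set U := {p : ℝ × ℝ | ∃ i n : ℕ,
    analyticOrderAt (fun t => (partialX^[i] (partialX f)) (γ.par t)) 0 = n ∧
    (i : ℝ) ≤ p.1 ∧ (n : ℝ) / γ.ram ≤ p.2} with hUdef
  have hclosed : IsClosed (convexHull ℝ U) := isClosed_convexHull_quadrants
    {x : ℕ × ℕ | analyticOrderAt (fun t => (partialX^[x.1] (partialX f)) (γ.par t)) 0 = x.2}
    γ.ram_pos
  have hU0 : convexHull ℝ U ⊆ Set.Ici 0 := by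
    refine convexHull_min ?_ (convex_Ici _)
    rintro p ⟨i, n, -, h1, h2⟩
    exact ⟨le_trans (by simp) h1, le_trans (by simp; positivity) h2⟩
  apply Set.Subset.antisymm
  · refine convexHull_min (Set.union_subset ?_ ?_) (convex_convexHull ℝ _)
    · exact hclosed.frontier_subset.trans (convexHull_mono Set.subset_union_left)
    · exact Set.subset_union_right.trans (subset_convexHull ℝ _)
  · refine convexHull_min (Set.union_subset ?_ ?_) (convex_convexHull ℝ _)
    · exact (subset_convexHull ℝ U).trans ((subset_convexHull_frontier hclosed hU0).trans
        (convexHull_mono Set.subset_union_left))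
    · exact Set.subset_union_right.trans (subset_convexHull ℝ _)

/-- If the dots along `β` lie on or above lines of slope `-d` going left from dots along `γ`, and
these in turn lie on or above the line of slope `-d` through `(0, h - 1)`, then each dot along
`β` lies above a segment joining `(0, h - 1)` to a dot along `γ`. -/
theorem augmentedNewtonPolygon_subset {f : ℂ × ℂ → ℂ} (hf : AnalyticAt ℂ f 0)
    {γ β : PuiseuxArc} (hγ : IsPolarArc f γ) (hβ : IsPolarArc f β) {d : ℚ}
    (hh : polarHeight f β = polarHeight f γ) (hdom : NewtonDominates (partialX f) d γ β)
    (hline : ∀ (i : ℕ) (e : ℚ), ordAlong (partialX^[i] (partialX f)) γ = e →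
      polarHeight f γ - 1 ≤ e + d * i) :
    augmentedNewtonPolygon f β ⊆ augmentedNewtonPolygon f γ := by
  rw [augmentedNewtonPolygon_eq hf hβ.fn_zero, augmentedNewtonPolygon_eq hf hγ.fn_zero, hh]
  set P : ℝ × ℝ := ((0 : ℝ), (polarHeight f γ : ℝ) - 1) with hP
  set U := {p : ℝ × ℝ | ∃ (i : ℕ) (e : ℚ), ordAlong (partialX^[i] (partialX f)) γ = e ∧
    (i : ℝ) ≤ p.1 ∧ (e : ℝ) ≤ p.2} with hU
  refine convexHull_min (Set.union_subset ?_ ?_) (convex_convexHull ℝ _)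
  swap
  · exact Set.subset_union_right.trans (subset_convexHull ℝ _)
  rintro ⟨x, y⟩ ⟨i, e, he, hx, hy⟩
  simp only at hx hy
  have hi : i ≠ 0 := by
    rintro rfl
    rw [Function.iterate_zero, id, hβ.ordAlong_partialX] at he
    exact WithTop.top_ne_coe he
  obtain ⟨k, e', he', hle⟩ := hdom i e he
  have h1 := hline _ _ he'
  have hi' : (0 : ℝ) < i := by exact_mod_cast Nat.pos_of_ne_zero hi
  have hk' : (0 : ℝ) ≤ k := by positivity
  have h1' : (polarHeight f γ : ℝ) - 1 ≤ e' + d * (i + k) := by exact_mod_cast h1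
  have hle' : (e' : ℝ) + d * k ≤ e := by exact_mod_cast hle
  have hik : (0 : ℝ) < i + k := by positivity
  -- the point of the quadrant of `(i + k, e')` whose segment to `P` passes through `(x, y)`
  set q : ℝ × ℝ := ((i + k) / i * x, (i + k) / i * (y - k / (i + k) * P.2)) with hq
  have hqU : q ∈ U := by
    refine ⟨i + k, e', he', ?_, ?_⟩
    · simp only [hq]
      push_cast
      calc (i + k : ℝ) = (i + k) / i * i := by field_simp
        _ ≤ _ := by gcongr
    · simp only [hq, hP]
      have h2 : (k : ℝ) / (i + k) * ((polarHeight f γ : ℝ) - 1) ≤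
          k / (i + k) * (e' + d * (i + k)) := by
        gcongr
      calc (e' : ℝ) = (i + k) / i * (e' + d * k - k / (i + k) * (e' + d * (i + k))) := by
            field_simp
            ring
        _ ≤ _ := by
            gcongr
            linarith
  have hseg := (convex_convexHull ℝ (U ∪ {P})) (subset_convexHull ℝ _ (Or.inl hqU))
    (subset_convexHull ℝ _ (Or.inr rfl)) (a := i / (i + k)) (b := k / (i + k)) (by positivity)
    (by positivity) (by field_simp)
  convert hseg using 1
  ext
  · simp [hq, hP]
    field_simp
  · simp [hq, hP]
    field_simp
    ring

theorem augmentedNewtonPolygon_eq_of_mem_canyonOf {f : ℂ × ℂ → ℂ} (hf : AnalyticAt ℂ f 0)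
    (hf0 : f 0 = 0) {γ β : PuiseuxArc} (hγ : IsPolarArc f γ) (hβ : IsPolarArc f β) {d : ℚ}
    (hd : IsGradientDegree f γ d) (hd1 : 1 < d) (hmem : β.curveGerm ∈ canyonOf γ d) :
    augmentedNewtonPolygon f β = augmentedNewtonPolygon f γ := by
  obtain ⟨hh, h1, h2⟩ := polarHeight_eq_and_newtonDominates hf hf0 hγ hβ hd hd1 hmem
  have hline : ∀ (i : ℕ) (e : ℚ), ordAlong (partialX^[i] (partialX f)) γ = e →
      polarHeight f γ - 1 ≤ e + d * i := fun i e he => polarHeight_sub_one_le hf hf0 hγ hd he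
  refine (augmentedNewtonPolygon_subset hf hγ hβ hh h1 hline).antisymm
    (augmentedNewtonPolygon_subset hf hβ hγ hh.symm h2 fun i e he => ?_)
  obtain ⟨k, e', he', hle⟩ := h1 i e he
  have := hline _ _ he'
  push_cast at this
  rw [hh]
  linarith

theorem mainTheorem6 (f : ℂ × ℂ → ℂ) (hf : AnalyticAt ℂ f 0) (hf0 : f 0 = 0)
    (hreg : MiniRegularInX f) :
    (∀ (C : Set (Filter.Germ (nhds (0 : ℂ × ℂ)) Prop)) (d : ℚ),
      IsGradientCanyon f C d → 1 < d →
      ∀ γ₁ γ₂ : PuiseuxArc, IsPolarArc f γ₁ → IsPolarArc f γ₂ →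
        γ₁.curveGerm ∈ C → γ₂.curveGerm ∈ C →
        augmentedNewtonPolygon f γ₁ = augmentedNewtonPolygon f γ₂) ∧
    ∃ P : Set (Filter.Germ (nhds (0 : ℂ × ℂ)) Prop) → Set (ℝ × ℝ),
      ∀ (C : Set (Filter.Germ (nhds (0 : ℂ × ℂ)) Prop)) (d : ℚ),
        IsGradientCanyon f C d → 1 < d →
        ∀ γ : PuiseuxArc, IsPolarArc f γ → γ.curveGerm ∈ C →
          augmentedNewtonPolygon f γ = P C := by
  have hfst : ∀ (C : Set (Filter.Germ (nhds (0 : ℂ × ℂ)) Prop)) (d : ℚ),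
      IsGradientCanyon f C d → 1 < d →
      ∀ γ₁ γ₂ : PuiseuxArc, IsPolarArc f γ₁ → IsPolarArc f γ₂ →
        γ₁.curveGerm ∈ C → γ₂.curveGerm ∈ C →
        augmentedNewtonPolygon f γ₁ = augmentedNewtonPolygon f γ₂ := by
    rintro C d ⟨γ, hγ, hd, rfl⟩ hd1 γ₁ γ₂ h₁ h₂ hC₁ hC₂
    rw [augmentedNewtonPolygon_eq_of_mem_canyonOf hf hf0 hγ h₁ hd hd1 hC₁,
      augmentedNewtonPolygon_eq_of_mem_canyonOf hf hf0 hγ h₂ hd hd1 hC₂]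
  -- `P C` is the union of the polygons of all polar arcs in `C`, which coincide
  refine ⟨hfst, fun C => ⋃ (γ : PuiseuxArc) (_ : IsPolarArc f γ ∧ γ.curveGerm ∈ C),
    augmentedNewtonPolygon f γ, fun C d hC hd1 γ hγ hγC => ?_⟩
  apply Set.Subset.antisymm
  · exact Set.subset_iUnion₂_of_subset γ ⟨hγ, hγC⟩ subset_rfl
  · exact Set.iUnion₂_subset fun γ' h' => (hfst C d hC hd1 γ' γ h'.1 hγ h'.2 hγC).le
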